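/- Let $F$ be a totally real number field with ring of integers $\mathcal{O}_F$, finite adele ring $\mathbb{A}_{f,F}$ and $\widehat{\mathcal{O}}_F=\prod_v\mathcal{O}_{F,v}\subset\mathbb{A}_{f,F}$. Put $\mathcal{O}_F^\natural:=\mathcal{O}_F\cap F^\times$ and $\mathrm{M}_2(\widehat{\mathcal{O}}_F)^\natural:=\mathrm{GL}_2(\mathbb{A}_{f,F})\cap\mathrm{M}_2(\widehat{\mathcal{O}}_F)$, and embed $F^\times$ in $\mathrm{GL}_2(\mathbb{A}_{f,F})$ as scalar matrices. For a monoid $S$ and a central submonoid $N$, $N\backslash S$ denotes the quotient of $S$ by the equivalence relation generated by $x\sim nx$ $(n\in N)$. For the Hilbert modular BCM pair of $F$ (with $G=\mathrm{Res}_{F/\mathbb{Q}}\mathrm{GL}_2$, centre $C=\mathrm{Res}_{F/\mathbb{Q}}\mathbb{G}_m$, $\phi$ the inclusion $\mathrm{GL}_2(\mathbb{A}_{f,F})\subset \mathrm{M}_2(\mathbb{A}_{f,F})$, and $K_M=\mathrm{M}_2(\widehat{\mathcal{O}}_F)$), the finite symmetry semigroup is $\mathrm{Sym}_f=\phi^{-1}(K_M)=\mathrm{M}_2(\widehat{\mathcal{O}}_F)^\natural$,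 the symmetry semigroup is $\mathrm{Sym}=\mathrm{Sym}_f\times C(\mathbb{R})$ with $C(\mathbb{R})=(F\otimes_{\mathbb{Q}}\mathbb{R})^\times$, the inner symmetry semigroup is $\mathrm{Inn}=C(\mathbb{Q})\cap\phi^{-1}(\text{centre of }K_M)$, embedded diagonally in $\mathrm{Sym}$, and the outer symmetry semigroup is $\mathrm{Out}=\mathrm{Inn}\backslash\mathrm{Sym}$. Then: (1) the natural map $\mathcal{O}_F^\natural\backslash\mathrm{M}_2(\widehat{\mathcal{O}}_F)^\natural\to F^\times\backslash\mathrm{GL}_2(\mathbb{A}_{f,F})$ induced by the inclusion is an isomorphism of semigroups; (2) the natural map $\mathrm{Out}\to F^\times\backslash\bigl(\mathrm{GL}_2(\mathbb{A}_{f,F})\times(F\otimes_{\mathbb{Q}}\mathbb{R})^\times\bigr)$ induced by the inclusion, where $F^\times$ is embedded diagonally, is an isomorphism of semigroups. -/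

import Mathlib

open IsDedekindDomain Matrix
open scoped NumberField TensorProduct

/-- The quotient `N \ M` of a monoid `M` by a central submonoid `N`: the congruence identifying
`x` and `y` when `a * x = b * y` for some `a b ∈ N`. This is the equivalence relation generated by
`x ∼ n * x` for `n ∈ N`. -/
def centralQuotientCon {M : Type*} [Monoid M] (N : Submonoid M)
    (hN : N ≤ Submonoid.center M) : Con M where
  r x y := ∃ a ∈ N, ∃ b ∈ N, a * x = b * y
  iseqv :=
    { refl := fun _ => ⟨1, N.one_mem, 1, N.one_mem, rfl⟩
      symm := by
        rintro x y ⟨a, ha, b, hb, h⟩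
        exact ⟨b, hb, a, ha, h.symm⟩
      trans := by
        rintro x y z ⟨a, ha, b, hb, h⟩ ⟨c, hc, d, hd, h'⟩
        refine ⟨c * a, N.mul_mem hc ha, b * d, N.mul_mem hb hd, ?_⟩
        have hcb : c * b = b * c := (Submonoid.mem_center_iff.mp (hN hb) c)
        rw [mul_assoc, h, ← mul_assoc, hcb, mul_assoc, h', ← mul_assoc] }
  mul' := by
    rintro w x y z ⟨a, ha, b, hb, h⟩ ⟨c, hc, d, hd, h'⟩
    refine ⟨a * c, N.mul_mem ha hc, b * d, N.mul_mem hb hd, ?_⟩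
    have h1 : w * c = c * w := Submonoid.mem_center_iff.mp (hN hc) w
    have h2 : x * d = d * x := Submonoid.mem_center_iff.mp (hN hd) x
    calc a * c * (w * y) = a * (c * w) * y := by simp only [mul_assoc]
      _ = (a * w) * (c * y) := by rw [← h1]; simp only [mul_assoc]
      _ = (b * x) * (d * z) := by rw [h, h']
      _ = b * (x * d) * z := by simp only [mul_assoc]
      _ = b * d * (x * z) := by rw [h2]; simp only [mul_assoc]

namespace HilbertModularBCM

noncomputable section

variable (F : Type*) [Field F] [NumberField F]

/-- The ring `𝔸_{f,F}` of finite adeles of `F`. -/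
abbrev FinAdele : Type _ := FiniteAdeleRing (𝓞 F) F

/-- The ring `Ô_F = ∏ᵥ O_{F,v}` of integral finite adeles. -/
def integralAdele : Subring (FinAdele F) where
  carrier := {a | ∀ v : HeightOneSpectrum (𝓞 F), a v ∈ v.adicCompletionIntegers F}
  mul_mem' ha hb v := mul_mem (ha v) (hb v)
  one_mem' v := one_mem (v.adicCompletionIntegers F)
  add_mem' ha hb v := add_mem (ha v) (hb v)
  zero_mem' v := zero_mem (v.adicCompletionIntegers F)
  neg_mem' ha v := neg_mem (ha v)

/-- `F ⊗_ℚ ℝ`; its unit group is `C(ℝ)`, where `C = Res_{F/ℚ} 𝔾_m` is the centre of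
`G = Res_{F/ℚ} GL₂`. -/
abbrev RealAlg : Type _ := F ⊗[ℚ] ℝ

/-- The group `G(𝔸_f) = GL₂(𝔸_{f,F})`. -/
abbrev GAf : Type _ := GL (Fin 2) (FinAdele F)

/-- The monoid `M(𝔸_f) = M₂(𝔸_{f,F})`. -/
abbrev MAf : Type _ := Matrix (Fin 2) (Fin 2) (FinAdele F)

/-- The inclusion `φ : G(𝔸_f) → M(𝔸_f)`. -/
abbrev phi : GAf F →* MAf F := Units.coeHom (MAf F)

/-- The level semigroup `K_M = M₂(Ô_F)`. -/
def KM : Submonoid (MAf F) := (integralAdele F).matrix.toSubmonoid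

/-- The centre `C K_M` of `K_M`, as a submonoid of `M(𝔸_f)`. -/
def CKM : Submonoid (MAf F) := (Submonoid.center (KM F)).map (KM F).subtype

/-- `C(ℚ) = Fˣ → G(𝔸_f)`, as scalar matrices. -/
def scalarFin : Fˣ →* GAf F :=
  (GeneralLinearGroup.scalar (Fin 2)).comp (Units.map (algebraMap F (FinAdele F)).toMonoidHom)

/-- `C(ℚ) = Fˣ → C(ℝ) = (F ⊗ ℝ)ˣ`. -/
def realUnit : Fˣ →* (RealAlg F)ˣ :=
  Units.map (Algebra.TensorProduct.includeLeftRingHom : F →+* F ⊗[ℚ] ℝ).toMonoidHom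

/-- The diagonal embedding of `C(ℚ) = Fˣ` into `G(𝔸_f) × C(ℝ)`. -/
def diag : Fˣ →* GAf F × (RealAlg F)ˣ := (scalarFin F).prod (realUnit F)

/-- `O_F^♮ = O_F ∩ Fˣ`. -/
def OFnat : Submonoid Fˣ :=
  (algebraMap (𝓞 F) F).range.toSubmonoid.comap (Units.coeHom F)

/-- The finite symmetry semigroup `Sym_f = φ⁻¹(K_M) = M₂(Ô_F)^♮ = GL₂(𝔸_{f,F}) ∩ M₂(Ô_F)`. -/
def SymFin : Submonoid (GAf F) := (KM F).comap (phi F)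

/-- The symmetry semigroup `Sym = Sym_f × C(ℝ)`, inside `G(𝔸_f) × C(ℝ)`. -/
def Sym : Submonoid (GAf F × (RealAlg F)ˣ) := (SymFin F).prod ⊤

/-- The inner symmetry semigroup `Inn = C(ℚ) ∩ φ⁻¹(C K_M)`. -/
def Inn : Submonoid Fˣ := (CKM F).comap ((phi F).comp (scalarFin F))

theorem scalarFin_mul_comm (c : Fˣ) (g : GAf F) : scalarFin F c * g = g * scalarFin F c :=
  GeneralLinearGroup.scalar_commute _ g

theorem diag_mul_comm (c : Fˣ) (g : GAf F × (RealAlg F)ˣ) : diag F c * g = g * diag F c :=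
  Prod.ext (scalarFin_mul_comm F c g.1) (mul_comm _ _)

theorem OFnat_map_le : (OFnat F).map (scalarFin F) ≤ SymFin F := by
  rintro _ ⟨c, ⟨r, hr⟩, rfl⟩ i j
  by_cases h : i = j
  · subst h
    intro v
    have h1 : (((scalarFin F c : GAf F) : MAf F) i i) v = ((c : F) : v.adicCompletion F) := by
      simp [scalarFin, GeneralLinearGroup.coe_scalar]
    have h2 : algebraMap (𝓞 F) F r = (c : F) := hr
    change (((scalarFin F c : GAf F) : MAf F) i i) v ∈ _
    rw [h1, ← h2]
    exact v.coe_mem_adicCompletionIntegers r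
  · have h1 : ((scalarFin F c : GAf F) : MAf F) i j = 0 := by
      simp [scalarFin, GeneralLinearGroup.coe_scalar, h]
    change ((scalarFin F c : GAf F) : MAf F) i j ∈ integralAdele F
    rw [h1]
    exact zero_mem _

theorem Inn_map_le : (Inn F).map (diag F) ≤ Sym F := by
  rintro _ ⟨c, ⟨m, -, hm⟩, rfl⟩
  refine ⟨?_, trivial⟩
  change phi F (scalarFin F c) ∈ KM F
  rw [← MonoidHom.comp_apply, ← hm]
  exact m.2

/-- `O_F^♮` as a submonoid of `M₂(Ô_F)^♮` (scalar matrices); it lies there by `OFnat_map_le`. -/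
def OFnatInSym : Submonoid (SymFin F) := ((OFnat F).map (scalarFin F)).comap (SymFin F).subtype

/-- `Inn` as a submonoid of `Sym`, embedded diagonally; it lies there by `Inn_map_le`. -/
def InnInSym : Submonoid (Sym F) := ((Inn F).map (diag F)).comap (Sym F).subtype

theorem OFnatInSym_le_center : OFnatInSym F ≤ Submonoid.center (SymFin F) := by
  rintro x ⟨c, -, hc⟩
  refine Submonoid.mem_center_iff.mpr fun g => Subtype.ext ?_
  have hc' : scalarFin F c = (x : GAf F) := hc
  change (g : GAf F) * x = x * g
  rw [← hc', scalarFin_mul_comm]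

theorem InnInSym_le_center : InnInSym F ≤ Submonoid.center (Sym F) := by
  rintro x ⟨c, -, hc⟩
  refine Submonoid.mem_center_iff.mpr fun g => Subtype.ext ?_
  have hc' : diag F c = (x : GAf F × (RealAlg F)ˣ) := hc
  change (g : GAf F × (RealAlg F)ˣ) * x = x * g
  rw [← hc', diag_mul_comm]

/-- The congruence defining `O_F^♮ \ M₂(Ô_F)^♮`. -/
def finCon : Con (SymFin F) := centralQuotientCon (OFnatInSym F) (OFnatInSym_le_center F)

/-- The congruence defining `Out = Inn \ Sym`. -/
def outCon : Con (Sym F) := centralQuotientCon (InnInSym F) (InnInSym_le_center F)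

/-- The semigroup `O_F^♮ \ M₂(Ô_F)^♮`. -/
abbrev FinQuot : Type _ := (finCon F).Quotient

/-- The outer symmetry semigroup `Out = Inn \ Sym`. -/
abbrev Out : Type _ := (outCon F).Quotient

instance scalarFin_range_normal : (scalarFin F).range.Normal where
  conj_mem := by
    rintro _ ⟨c, rfl⟩ g
    exact ⟨c, by rw [← scalarFin_mul_comm, mul_inv_cancel_right]⟩

instance diag_range_normal : (diag F).range.Normal where
  conj_mem := by
    rintro _ ⟨c, rfl⟩ g
    exact ⟨c, by rw [← diag_mul_comm, mul_inv_cancel_right]⟩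

/-- The group `Fˣ \ GL₂(𝔸_{f,F})`. -/
abbrev FinTarget : Type _ := GAf F ⧸ (scalarFin F).range

/-- The group `Fˣ \ (GL₂(𝔸_{f,F}) × (F ⊗ ℝ)ˣ)`, with `Fˣ` embedded diagonally. -/
abbrev OutTarget : Type _ := (GAf F × (RealAlg F)ˣ) ⧸ (diag F).range

end

end HilbertModularBCM

/-! Both parts are the same fact about fractions. Let a submonoid `N` of a group `A` act through
central elements on `G ⊇ S`. If every element of `A` is a quotient of two elements of `N`, then two
points of `S` in the same `A`-orbit are already identified by `N`, which gives injectivity. If `N`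
moves every element of `G` into `S`, then every orbit meets `S`, which gives surjectivity. The
arithmetic inputs are that `F` is the fraction field of `𝓞 F`, and that one nonzero integer clears
the denominators of all four entries of an adelic matrix, since a finite adele is non-integral at
only finitely many places. In the second part the archimedean factor imposes no condition, and `Inn`
need only contain `OFnat`, because both hypotheses on `N` persist when `N` is enlarged. -/

/-- If every element of `A` is a fraction of elements of `N`, and every element of `G` can be moved
into the submonoid `S` by an element of `N`, then `N \ S` is the group `A \ G`. -/
theorem Con.exists_mulEquiv_quotient_range {A G : Type*} [CommGroup A] [Group G] (f : A →* G)
    [f.range.Normal] (hf : ∀ a g, f a * g = g * f a) (N : Submonoid A)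
    (hN : ∀ c, ∃ a ∈ N, a * c ∈ N) (S : Submonoid G) (hS : ∀ g, ∃ a ∈ N, f a * g ∈ S)
    (r : Con S)
    (hr : ∀ x y : S, r x y ↔ ∃ a ∈ N, ∃ b ∈ N, f a * (x : G) = f b * y) :
    ∃ e : r.Quotient ≃* G ⧸ f.range, ∀ s : S, e (s : r.Quotient) = ((s : G) : G ⧸ f.range) := by
  have hmk (a : A) (g : G) : ((f a * g : G) : G ⧸ f.range) = g := by
    rw [QuotientGroup.mk_mul, (QuotientGroup.eq_one_iff (f a)).mpr (MonoidHom.mem_range.mpr ⟨a, rfl⟩), one_mul]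
  let q : S →* G ⧸ f.range := (QuotientGroup.mk' f.range).comp S.subtype
  have hle : r ≤ Con.ker q := by
    intro x y h
    obtain ⟨a, -, b, -, h⟩ := (hr x y).mp h
    change ((x : G) : G ⧸ f.range) = (y : G)
    rw [← hmk a, h, hmk b]
  refine ⟨MulEquiv.ofBijective (r.lift q hle) ⟨?_, ?_⟩, fun s => rfl⟩
  · intro x y
    induction x using Con.induction_on with | _ x
    induction y using Con.induction_on with | _ y
    intro h
    obtain ⟨c, hc⟩ := QuotientGroup.eq.mp (show ((x : G) : G ⧸ f.range) = (y : G) from h)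
    obtain ⟨a, ha, hac⟩ := hN c
    -- Here `f c = x⁻¹ * y` and `c = (a * c) / a` with both terms in `N`. By centrality, `f (a * c)
    -- * x = f a * (x * f c) = f a * y`.
    refine r.eq.mpr ((hr x y).mpr ⟨a * c, hac, a, ha, ?_⟩)
    rw [map_mul, mul_assoc, hf c, hc, mul_inv_cancel_left]
  · intro g
    induction g using QuotientGroup.induction_on with | _ g
    obtain ⟨a, -, h⟩ := hS g
    exact ⟨((⟨f a * g, h⟩ : S) : r.Quotient), hmk a g⟩

namespace HilbertModularBCM

variable (F : Type*) [Field F] [NumberField F]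

-- This lets denominators chosen separately be replaced by their product.
variable {F} in
theorem mul_mem_adicCompletionIntegers_of_dvd {v : HeightOneSpectrum (𝓞 F)}
    {x : v.adicCompletion F} {d e : 𝓞 F} (hde : d ∣ e)
    (hd : (algebraMap (𝓞 F) F d : v.adicCompletion F) * x ∈ v.adicCompletionIntegers F) :
    (algebraMap (𝓞 F) F e : v.adicCompletion F) * x ∈ v.adicCompletionIntegers F := by
  obtain ⟨c, rfl⟩ := hde
  have h : (algebraMap (𝓞 F) F (d * c) : v.adicCompletion F) * x =
      (algebraMap (𝓞 F) F c : v.adicCompletion F) * (algebraMap (𝓞 F) F d * x) := by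
    rw [mul_comm d c, map_mul, HeightOneSpectrum.adicCompletion.coe_mul, mul_assoc]
  rw [h]
  exact mul_mem (v.coe_mem_adicCompletionIntegers c) hd

/-- Each local component has a nonzero global denominator; the product over the finitely many
non-integral places serves everywhere, since at the remaining places a global integer preserves
integrality. -/
theorem exists_mul_mem_integralAdele (x : FinAdele F) :
    ∃ r : 𝓞 F, r ≠ 0 ∧ algebraMap F (FinAdele F) r * x ∈ integralAdele F := by
  classical
  -- The restricted product condition, read as finiteness of the exceptional set.
  have hx : {v : HeightOneSpectrum (𝓞 F) | x v ∉ v.adicCompletionIntegers F}.Finite := x.2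
  choose d hd0 hd using fun v : HeightOneSpectrum (𝓞 F) =>
    HeightOneSpectrum.adicCompletion.mul_nonZeroDivisor_mem_adicCompletionIntegers v (x v)
  refine ⟨∏ v ∈ hx.toFinset, d v,
    Finset.prod_ne_zero_iff.mpr fun v _ => nonZeroDivisors.ne_zero (hd0 v), fun v => ?_⟩
  by_cases hv : x v ∈ v.adicCompletionIntegers F
  · exact mul_mem (v.coe_mem_adicCompletionIntegers _) hv
  · refine mul_mem_adicCompletionIntegers_of_dvd
      (Finset.dvd_prod_of_mem d (hx.mem_toFinset.mpr hv)) ?_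
    rw [mul_comm]
    exact hd v

theorem exists_mul_mem_integralAdele_of_finite {ι : Type*} [Finite ι] (x : ι → FinAdele F) :
    ∃ r : 𝓞 F, r ≠ 0 ∧ ∀ i, algebraMap F (FinAdele F) r * x i ∈ integralAdele F := by
  have := Fintype.ofFinite ι
  choose d hd0 hd using fun i => exists_mul_mem_integralAdele F (x i)
  exact ⟨∏ i, d i, Finset.prod_ne_zero_iff.mpr fun i _ => hd0 i, fun i v =>
    mul_mem_adicCompletionIntegers_of_dvd (Finset.dvd_prod_of_mem d (Finset.mem_univ i)) (hd i v)⟩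

theorem exists_mul_mem_OFnat (c : Fˣ) : ∃ a ∈ OFnat F, a * c ∈ OFnat F := by
  obtain ⟨n, d, hd, h⟩ := IsFractionRing.div_surjective (A := 𝓞 F) (c : F)
  have hd0 : (d : F) ≠ 0 := by simpa using nonZeroDivisors.ne_zero hd
  -- With `c = n / d`, the denominator `d` is the witness, since `d * c = n`.
  refine ⟨Units.mk0 _ hd0, ⟨d, rfl⟩, n, ?_⟩
  simp [← h, mul_div_cancel₀ _ hd0]

theorem exists_scalarFin_mul_mem_SymFin (g : GAf F) :
    ∃ a ∈ OFnat F, scalarFin F a * g ∈ SymFin F := by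
  obtain ⟨r, hr, h⟩ := exists_mul_mem_integralAdele_of_finite F
    fun p : Fin 2 × Fin 2 => (g : MAf F) p.1 p.2
  have hr0 : (r : F) ≠ 0 := by simpa using hr
  refine ⟨Units.mk0 _ hr0, ⟨r, rfl⟩, fun i j => ?_⟩
  have : ((scalarFin F (Units.mk0 _ hr0) * g : GAf F) : MAf F) i j =
      algebraMap F (FinAdele F) r * (g : MAf F) i j := by
    simp [scalarFin, GeneralLinearGroup.coe_scalar]
  change ((scalarFin F (Units.mk0 _ hr0) * g : GAf F) : MAf F) i j ∈ integralAdele F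
  rw [this]
  exact h (i, j)

/-- An integral scalar matrix lies in `KM` and commutes with every matrix, so it is central there.
This inclusion carries the facts about `OFnat` over to `Inn`. -/
theorem OFnat_le_Inn : OFnat F ≤ Inn F := by
  intro c hc
  refine ⟨⟨phi F (scalarFin F c), OFnat_map_le F ⟨c, hc, rfl⟩⟩,
    Submonoid.mem_center_iff.mpr fun m => Subtype.ext ?_, rfl⟩
  exact (scalar_commute (algebraMap F (FinAdele F) c) (fun _ => mul_comm _ _) (m : MAf F)).symm

end HilbertModularBCM

theorem mainTheorem8 (F : Type*) [Field F] [NumberField F] [NumberField.IsTotallyReal F] :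
    (∃ e : HilbertModularBCM.FinQuot F ≃* HilbertModularBCM.FinTarget F,
      ∀ m : HilbertModularBCM.SymFin F,
        e (m : HilbertModularBCM.FinQuot F) =
          ((m : HilbertModularBCM.GAf F) : HilbertModularBCM.FinTarget F)) ∧
    (∃ e : HilbertModularBCM.Out F ≃* HilbertModularBCM.OutTarget F,
      ∀ s : HilbertModularBCM.Sym F,
        e (s : HilbertModularBCM.Out F) =
          ((s : HilbertModularBCM.GAf F × (HilbertModularBCM.RealAlg F)ˣ) :
            HilbertModularBCM.OutTarget F)) := by
  open HilbertModularBCM in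
  constructor
  · refine Con.exists_mulEquiv_quotient_range (scalarFin F) (scalarFin_mul_comm F) (OFnat F)
      (exists_mul_mem_OFnat F) (SymFin F) (exists_scalarFin_mul_mem_SymFin F) (finCon F)
      fun x y => ⟨?_, ?_⟩
    · rintro ⟨_, ⟨a, ha, ha'⟩, _, ⟨b, hb, hb'⟩, h⟩
      refine ⟨a, ha, b, hb, ?_⟩
      rw [ha', hb']
      exact congrArg Subtype.val h
    -- The congruence uses multipliers inside the semigroup, so the scalars must first be seen to
    -- lie in `SymFin`.
    · rintro ⟨a, ha, b, hb, h⟩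
      exact ⟨⟨_, OFnat_map_le F ⟨a, ha, rfl⟩⟩, ⟨a, ha, rfl⟩,
        ⟨_, OFnat_map_le F ⟨b, hb, rfl⟩⟩, ⟨b, hb, rfl⟩, Subtype.ext h⟩
  · refine Con.exists_mulEquiv_quotient_range (diag F) (diag_mul_comm F) (Inn F)
      (fun c => ?_) (Sym F) (fun g => ?_) (outCon F) fun x y => ⟨?_, ?_⟩
    · obtain ⟨a, ha, hac⟩ := exists_mul_mem_OFnat F c
      exact ⟨a, OFnat_le_Inn F ha, OFnat_le_Inn F hac⟩
    -- Only the finite component constrains membership in `Sym`; the real one is arbitrary.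
    · obtain ⟨a, ha, h⟩ := exists_scalarFin_mul_mem_SymFin F g.1
      exact ⟨a, OFnat_le_Inn F ha, h, trivial⟩
    · rintro ⟨_, ⟨a, ha, ha'⟩, _, ⟨b, hb, hb'⟩, h⟩
      refine ⟨a, ha, b, hb, ?_⟩
      rw [ha', hb']
      exact congrArg Subtype.val h
    · rintro ⟨a, ha, b, hb, h⟩
      exact ⟨⟨_, Inn_map_le F ⟨a, ha, rfl⟩⟩, ⟨a, ha, rfl⟩,
        ⟨_, Inn_map_le F ⟨b, hb, rfl⟩⟩, ⟨b, hb, rfl⟩, Subtype.ext h⟩
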